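/- \textbf{Setting.} Let $d_0,\dots,d_J\in\mathbb N$, let $D_j\in\mathbb R^{d_{j-1}\times d_j}$ $(1\le j\le J)$ be matrices (dictionaries) all of whose columns have Euclidean norm $1$, let $\mu(D_j)=\max_{i\ne k}|a_i^\top a_k|/(\|a_i\|_2\|a_k\|_2)$ be the mutual coherence of $D_j$, where $a_1,\dots,a_{d_j}$ are the columns of $D_j$ (and $\mu(D_j)=0$ if there is at most one column), and let $\lambda=(\lambda_1,\dots,\lambda_J)$ satisfy $\lambda_j<\frac12\bigl(1+\frac1{\mu(D_j)}\bigr)$ for all $j$, where $1/0=\infty$. Let $B=(B_j)$ and $\delta=(\delta_j)$ be real vectors. Call $(y;x_1,\dots,x_J)$ with $y=:x_0\in\mathbb R^{d_0}$, $x_j\in\mathbb R^{d_j}$ \emph{admissible} if, for every $j=1,\dots,J$, $x_j$ has at most $\lambda_j$ nonzero entries, all entries of $x_j$ are at most $B_j$ in absolute value, and the noise $\varepsilon_j=x_{j-1}-D_jx_j$ satisfies $\|\varepsilon_j\|_1\le\delta_j$ (so $x_1,\dots,x_J$ are sparse codings of $y$ in the deep sparse coding problem $\|x_{j-1}-D_jx_j\|_2\le\tau_j$,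 $\|x_j\|_0\le\lambda_j$, for any tolerances $\tau_j\ge\|\varepsilon_j\|_2$). A $\rho$-network, for $\rho:\mathbb R\to\mathbb R$, is a finite composition of layers $v\mapsto Wv+b$ and $v\mapsto\rho(Wv+b)$ ($\rho$ acting on every coordinate); its depth is its number of layers, its number of weights is the number of entries of all matrices $W$ and vectors $b$, and an intermediate output is the output of one of its layers (or its input). Let $\sigma(t)=\max\{t,0\}$. \textbf{Theorem.} There are constants $A$, depending only on $J,d_0,\dots,d_J$, $c>0$, depending only on $\{D_j\}_{j=1}^J$ and $\lambda$, and $C>0$, depending only on $\{D_j\}_{j=1}^J$, $\lambda$ and $B$, such that the following holds for every integer $K\ge1$ and every $\delta$. Let $M$ be large enough, that is, $M\ge M_0$ for some $M_0$ that depends only on $\{D_j\}_{j=1}^J,\lambda,B,\delta$ and $K$. Let $\rho:\mathbb R\to\mathbb R$ be any activation function, and let $\phi_\rho:\mathbb R\to\mathbb R$ be a $\rho$-network with $\sup_{|t|\le M}|\phi_\rho(t)-\sigma(t)|\le\varepsilon$. Then there exists a $\rho$-network $\Phi_\rho$ with input in $\mathbb R^{d_0}$, of depth at most $AK(\operatorname{depth}(\phi_\rho)+1)$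 and with at most $AK(W(\phi_\rho)+1)$ weights, where $W(\phi_\rho)$ is the number of weights of $\phi_\rho$, which has $J$ intermediate outputs such that, for every admissible $(y;x_1,\dots,x_J)$, the values $\tilde x_j\in\mathbb R^{d_j}$ of these intermediate outputs at the input $y$ satisfy \[ \|\tilde x_j-x_j\|_2\le C e^{-cK}+C\sum_{i=1}^{j}\delta_i+C\varepsilon,\qquad j=1,\dots,J . \] -/

import Mathlib

namespace DeepSparseCoding

/-- The Euclidean norm of a vector of `ℝⁿ`. -/
noncomputable def l2norm {n : ℕ} (v : Fin n → ℝ) : ℝ :=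
  ‖(WithLp.toLp 2 v : EuclideanSpace ℝ (Fin n))‖

/-- The `ℓ₁` norm of a vector of `ℝⁿ`. -/
def l1norm {n : ℕ} (v : Fin n → ℝ) : ℝ :=
  ∑ i, |v i|

/-- Every column of the dictionary has Euclidean norm one. -/
def ColumnNormalized {m n : ℕ} (A : Matrix (Fin m) (Fin n) ℝ) : Prop :=
  ∀ k, l2norm (A.col k) = 1

/-- The mutual coherence `μ(A) = max_{i ≠ k} |aᵢᵀ aₖ| / (‖aᵢ‖₂ ‖aₖ‖₂)`, where `aᵢ` is the `i`-th
column of `A`. It is `0` when `A` has at most one column. -/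
noncomputable def mutualCoherence {m n : ℕ} (A : Matrix (Fin m) (Fin n) ℝ) : ℝ :=
  ⨆ p : {p : Fin n × Fin n // p.1 ≠ p.2},
    |A.col p.1.1 ⬝ᵥ A.col p.1.2| / (l2norm (A.col p.1.1) * l2norm (A.col p.1.2))

/-- A set of dictionaries `D₁, …, D_J` with `D_j ∈ ℝ^{d_{j-1} × d_j}`. -/
abbrev Dictionaries {J : ℕ} (d : Fin (J + 1) → ℕ) : Type :=
  (j : Fin J) → Matrix (Fin (d j.castSucc)) (Fin (d j.succ)) ℝ

/-- The uniqueness condition `λ_j < (1 + 1 / μ(D_j)) / 2` for every `j`, with `1 / 0 = ∞`. -/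
def UniquenessCondition {J : ℕ} {d : Fin (J + 1) → ℕ} (D : Dictionaries d)
    (lam : Fin J → ℝ) : Prop :=
  ∀ j, 0 < mutualCoherence (D j) → lam j < 1 / 2 * (1 + 1 / mutualCoherence (D j))

/-- The noise vector `ε_j = x_{j-1} - D_j x_j` of the `j`-th linear system. -/
def noise {J : ℕ} {d : Fin (J + 1) → ℕ} (D : Dictionaries d)
    (x : (j : Fin (J + 1)) → Fin (d j) → ℝ) (j : Fin J) : Fin (d j.castSucc) → ℝ :=
  x j.castSucc - (D j).mulVec (x j.succ)

/-- `x₁, …, x_J` are sparse codings of the observation `y` in the deep sparse coding problem with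
sparsity vector `lam` and tolerance vector `tol`; the entry `x 0` is the observation. -/
structure IsSparseCoding {J : ℕ} {d : Fin (J + 1) → ℕ} (D : Dictionaries d)
    (lam tol : Fin J → ℝ) (y : Fin (d 0) → ℝ) (x : (j : Fin (J + 1)) → Fin (d j) → ℝ) : Prop where
  observation : x 0 = y
  fidelity : ∀ j, l2norm (noise D x j) ≤ tol j
  sparsity : ∀ j : Fin J, (hammingNorm (x j.succ) : ℝ) ≤ lam j

/-- The class `𝕏(B, δ)` of pairs (signal, noise) with `|xᵢ| ≤ B` for all `i` and `‖e‖₁ ≤ δ`. -/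
def boundedClass (m n : ℕ) (B δ : ℝ) : Set ((Fin n → ℝ) × (Fin m → ℝ)) :=
  {p | (∀ i, |p.1 i| ≤ B) ∧ l1norm p.2 ≤ δ}

/-- Feed-forward neural networks with inputs in `ℝⁿ`, as finite sequences of layers. A layer is an
affine map `v ↦ W v + b`, which is followed by the activation function in every coordinate
(`activated`) or is left as it is (`linear`, as in the last layer of a usual network). -/
inductive Network (n : ℕ) : ℕ → Type
  | input : Network n n
  | linear {k m : ℕ} (Φ : Network n k) (W : Matrix (Fin m) (Fin k) ℝ) (b : Fin m → ℝ) :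
      Network n m
  | activated {k m : ℕ} (Φ : Network n k) (W : Matrix (Fin m) (Fin k) ℝ) (b : Fin m → ℝ) :
      Network n m

namespace Network

/-- The function computed by a network whose activation function is `ρ`. -/
def eval (ρ : ℝ → ℝ) {n : ℕ} : {m : ℕ} → Network n m → (Fin n → ℝ) → (Fin m → ℝ)
  | _, input, v => v
  | _, linear Φ W b, v => W.mulVec (Φ.eval ρ v) + b
  | _, activated Φ W b, v => fun i => ρ ((W.mulVec (Φ.eval ρ v) + b) i)

/-- The number of layers. -/
def depth {n : ℕ} : {m : ℕ} → Network n m → ℕ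
  | _, input => 0
  | _, linear Φ _ _ => Φ.depth + 1
  | _, activated Φ _ _ => Φ.depth + 1

/-- The number of weights: all entries of the matrices and of the bias vectors. -/
def numWeights {n : ℕ} : {m : ℕ} → Network n m → ℕ
  | _, input => 0
  | m, linear (k := k) Φ _ _ => Φ.numWeights + (m * k + m)
  | m, activated (k := k) Φ _ _ => Φ.numWeights + (m * k + m)

/-- `IsInitialSegment Ψ Φ` says that `Ψ` consists of the first layers of `Φ`, so that the function
computed by `Ψ` is an intermediate output of `Φ`, namely the output of one of its layers. -/
inductive IsInitialSegment {n k : ℕ} (Ψ : Network n k) : {m : ℕ} → Network n m → Prop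
  | refl : IsInitialSegment Ψ Ψ
  | linear {l m : ℕ} {Φ : Network n l} (h : IsInitialSegment Ψ Φ)
      (W : Matrix (Fin m) (Fin l) ℝ) (b : Fin m → ℝ) : IsInitialSegment Ψ (Φ.linear W b)
  | activated {l m : ℕ} {Φ : Network n l} (h : IsInitialSegment Ψ Φ)
      (W : Matrix (Fin m) (Fin l) ℝ) (b : Fin m → ℝ) : IsInitialSegment Ψ (Φ.activated W b)

end Network

/-- The rectified linear unit. -/
def relu (t : ℝ) : ℝ := max t 0

/-- The network `φ` with activation function `ρ` approximates the rectified linear unit uniformly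
on `[-M, M]` within `ε`. -/
def ApproximatesReLU (ρ : ℝ → ℝ) (φ : Network 1 1) (M ε : ℝ) : Prop :=
  ∀ t ∈ Set.Icc (-M) M, |φ.eval ρ (fun _ => t) 0 - relu t| ≤ ε

end DeepSparseCoding

open DeepSparseCoding

namespace DeepSparseCoding

/-! Iterative soft thresholding converges linearly on sparse vectors, and each step is a small
network. Let `z` have maximal error `E` and be nearly zero off the support of `x`. As the columns
are unit vectors, the gradient step `z + Dᵀ(w - D z)` sees the errors of the other coordinates only
through inner products of size at most `μ`. Its error is at most about `μ λ E` off the support and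
`μ (λ - 1) E` on it. Thresholding at `μ λ E` plus noise removes the former and adds `μ λ E` to the
latter, so `E` shrinks by `μ (2 λ - 1)`, which is below 1 exactly by the uniqueness condition
(`thresholding_step`, `thresholding_error`).

A soft threshold is a difference of two ReLUs. Replacing ReLU by `t ↦ L⁻¹ φ(L t)` costs `ε / L` each
time; with `L = K` the `K` steps accumulate only `O(ε)` (`rescale`, `exists_recovery`). Finally, the
error of one recovered code is extra noise for the next dictionary, so the networks can be chained.
-/

/-! ### Norms and mutual coherence. -/

lemma l2norm_nonneg {n : ℕ} (v : Fin n → ℝ) : 0 ≤ l2norm v := norm_nonneg _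

lemma l2norm_zero {n : ℕ} : l2norm (0 : Fin n → ℝ) = 0 := by simp [l2norm]

lemma l2norm_add_le {n : ℕ} (v w : Fin n → ℝ) : l2norm (v + w) ≤ l2norm v + l2norm w := by
  simpa [l2norm] using norm_add_le (WithLp.toLp 2 v : EuclideanSpace ℝ (Fin n)) (WithLp.toLp 2 w)

lemma l2norm_le_l1norm {n : ℕ} (v : Fin n → ℝ) : l2norm v ≤ l1norm v := by
  rw [l2norm, EuclideanSpace.norm_eq, l1norm]
  refine Real.sqrt_le_iff.mpr ⟨Finset.sum_nonneg fun i _ => abs_nonneg _, ?_⟩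
  simpa using Finset.sum_sq_le_sq_sum_of_nonneg fun i (_ : i ∈ Finset.univ) => abs_nonneg (v i)

lemma l2norm_le_of_abs_le {n : ℕ} {v : Fin n → ℝ} {a : ℝ} (h : ∀ i, |v i| ≤ a) :
    l2norm v ≤ n * a := by
  refine (l2norm_le_l1norm v).trans ?_
  simpa [l1norm] using Finset.sum_le_sum fun i (_ : i ∈ Finset.univ) => h i

lemma abs_apply_le_l2norm {n : ℕ} (v : Fin n → ℝ) (i : Fin n) : |v i| ≤ l2norm v := by
  simpa [l2norm] using PiLp.norm_apply_le (WithLp.toLp 2 v : EuclideanSpace ℝ (Fin n)) i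

lemma abs_dotProduct_le {n : ℕ} (v w : Fin n → ℝ) : |v ⬝ᵥ w| ≤ l2norm v * l2norm w := by
  have := abs_real_inner_le_norm (WithLp.toLp 2 w : EuclideanSpace ℝ (Fin n)) (WithLp.toLp 2 v)
  rw [mul_comm]
  simpa [l2norm, EuclideanSpace.inner_eq_star_dotProduct] using this

lemma dotProduct_self_eq_l2norm_sq {n : ℕ} (v : Fin n → ℝ) : v ⬝ᵥ v = l2norm v ^ 2 := by
  rw [l2norm, ← real_inner_self_eq_norm_sq, EuclideanSpace.inner_eq_star_dotProduct]
  rfl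

lemma mutualCoherence_nonneg {m n : ℕ} (D : Matrix (Fin m) (Fin n) ℝ) :
    0 ≤ mutualCoherence D :=
  -- This includes the empty index set, where the real supremum is 0.
  Real.iSup_nonneg fun _ =>
    div_nonneg (abs_nonneg _) (mul_nonneg (l2norm_nonneg _) (l2norm_nonneg _))

lemma ColumnNormalized.abs_dotProduct_col_le {m n : ℕ} {D : Matrix (Fin m) (Fin n) ℝ}
    (hD : ColumnNormalized D) {i j : Fin n} (hij : i ≠ j) :
    |D.col i ⬝ᵥ D.col j| ≤ mutualCoherence D := by
  have h := le_ciSup (f := fun p : {p : Fin n × Fin n // p.1 ≠ p.2} =>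
    |D.col p.1.1 ⬝ᵥ D.col p.1.2| / (l2norm (D.col p.1.1) * l2norm (D.col p.1.2)))
    (Set.finite_range _).bddAbove ⟨(i, j), hij⟩
  simp only [hD i, hD j, mul_one, div_one] at h
  simpa only [mutualCoherence, hD _, mul_one, div_one] using h

/-! ### One step of thresholded gradient descent. -/

/-- The error of a gradient step for the least squares functional. -/
lemma ColumnNormalized.abs_gradient_step_sub_le {m n : ℕ} {D : Matrix (Fin m) (Fin n) ℝ}
    (hD : ColumnNormalized D) {x z : Fin n → ℝ} {w : Fin m → ℝ} {E κ η : ℝ} (hκ : 0 ≤ κ)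
    (hw : l2norm (w - D.mulVec x) ≤ η) (hz : ∀ i, |z i - x i| ≤ E)
    (hz₀ : ∀ i, x i = 0 → |z i| ≤ κ) (i : Fin n) :
    |(z + D.transpose.mulVec (w - D.mulVec z)) i - x i| ≤
      mutualCoherence D * (({j ∈ Finset.univ.erase i | x j ≠ 0}.card : ℝ) * E + n * κ) + η := by
  -- The diagonal of `Dᵀ D` is 1, so the error of coordinate `i` itself cancels.
  have hsplit : (z + D.transpose.mulVec (w - D.mulVec z)) i - x i =
      -(∑ j ∈ Finset.univ.erase i, (D.col i ⬝ᵥ D.col j) * (z j - x j)) +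
        D.col i ⬝ᵥ (w - D.mulVec x) := by
    have h1 : D.col i ⬝ᵥ D.mulVec (z - x) = ∑ j, (D.col i ⬝ᵥ D.col j) * (z j - x j) := by
      simp only [dotProduct, Matrix.mulVec, Finset.mul_sum, Finset.sum_mul, Pi.sub_apply,
        Matrix.col_apply]
      rw [Finset.sum_comm]
      exact Finset.sum_congr rfl fun _ _ => Finset.sum_congr rfl fun _ _ => by ring
    rw [← Finset.add_sum_erase _ _ (Finset.mem_univ i), dotProduct_self_eq_l2norm_sq, hD i] at h1
    have h2 : (D.transpose.mulVec (w - D.mulVec z)) i = D.col i ⬝ᵥ (w - D.mulVec z) := rfl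
    have h3 : w - D.mulVec z = (w - D.mulVec x) - D.mulVec (z - x) := by
      rw [Matrix.mulVec_sub]; abel
    rw [Pi.add_apply, h2, h3, dotProduct_sub, h1]
    ring
  have hsum : |∑ j ∈ Finset.univ.erase i, (D.col i ⬝ᵥ D.col j) * (z j - x j)| ≤
      mutualCoherence D * (({j ∈ Finset.univ.erase i | x j ≠ 0}.card : ℝ) * E + n * κ) := by
    calc _ ≤ ∑ j ∈ Finset.univ.erase i, |(D.col i ⬝ᵥ D.col j) * (z j - x j)| :=
          Finset.abs_sum_le_sum_abs _ _
      _ ≤ ∑ j ∈ Finset.univ.erase i, mutualCoherence D * ((if x j ≠ 0 then E else 0) + κ) := by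
          refine Finset.sum_le_sum fun j hj => ?_
          rw [abs_mul]
          refine mul_le_mul (hD.abs_dotProduct_col_le (Finset.ne_of_mem_erase hj).symm) ?_
            (abs_nonneg _) (mutualCoherence_nonneg D)
          split_ifs with h
          · linarith [hz j]
          · have h0 := not_not.mp h
            simpa [h0] using hz₀ j h0
      _ = mutualCoherence D * (({j ∈ Finset.univ.erase i | x j ≠ 0}.card : ℝ) * E +
            ((Finset.univ.erase i).card : ℝ) * κ) := by
          rw [← Finset.mul_sum, Finset.sum_add_distrib, ← Finset.sum_filter]
          simp
      _ ≤ _ := by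
          have : ((Finset.univ.erase i).card : ℝ) ≤ n := by
            exact_mod_cast (Finset.card_le_univ _).trans (by simp)
          have h0 := mutualCoherence_nonneg D
          gcongr
  have hdot : |D.col i ⬝ᵥ (w - D.mulVec x)| ≤ η := by
    have := abs_dotProduct_le (D.col i) (w - D.mulVec x)
    rw [hD i, one_mul] at this
    exact this.trans hw
  rw [hsplit]
  refine (abs_add_le _ _).trans ?_
  rw [abs_neg]
  exact add_le_add hsum hdot

/-- Thresholding with level `θ`, built from two copies of `f`; it is soft thresholding if `f` is the
rectified linear unit. -/
def softThreshold (f : ℝ → ℝ) (θ t : ℝ) : ℝ := f (t - θ) - f (-t - θ)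

lemma softThreshold_relu_eq_zero {θ t : ℝ} (h : |t| ≤ θ) : softThreshold relu θ t = 0 := by
  obtain ⟨h1, h2⟩ := abs_le.mp h
  simp only [softThreshold, relu]
  rw [max_eq_right (by linarith), max_eq_right (by linarith), sub_zero]

/-- For `θ = 0` this is the identity `t = relu t - relu (-t)`, by which data can be carried through
activated layers. -/
lemma abs_softThreshold_relu_sub_le {θ : ℝ} (hθ : 0 ≤ θ) (t : ℝ) :
    |softThreshold relu θ t - t| ≤ θ := by
  simp only [softThreshold, relu]
  rw [abs_le]
  rcases max_cases (t - θ) 0 with h | h <;> rcases max_cases (-t - θ) 0 with h' | h' <;>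
    constructor <;> linarith

lemma abs_softThreshold_sub_relu_le {f : ℝ → ℝ} {R κ θ t : ℝ}
    (hf : ∀ s, |s| ≤ R → |f s - relu s| ≤ κ / 2) (h : |t| + θ ≤ R) (hθ : 0 ≤ θ) :
    |softThreshold f θ t - softThreshold relu θ t| ≤ κ := by
  have h1 := hf (t - θ) ((abs_sub _ _).trans (by rwa [abs_of_nonneg hθ]))
  have h2 := hf (-t - θ) ((abs_sub _ _).trans (by rwa [abs_of_nonneg hθ, abs_neg]))
  simp only [softThreshold]
  rw [abs_le] at *
  constructor <;> linarith

/-- One step of iterative soft thresholding contracts the maximal error, up to the noise. -/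
lemma ColumnNormalized.thresholding_step {m n : ℕ} {D : Matrix (Fin m) (Fin n) ℝ}
    (hD : ColumnNormalized D) {lam q : ℝ} (hq₀ : 0 ≤ q)
    (hq : mutualCoherence D * (2 * lam - 1) ≤ q) {f : ℝ → ℝ} {R κ E η B : ℝ}
    (hf : ∀ s, |s| ≤ R → |f s - relu s| ≤ κ / 2) (hκ : 0 ≤ κ) (hE : 0 ≤ E)
    {x z : Fin n → ℝ} {w : Fin m → ℝ} (hx : (hammingNorm x : ℝ) ≤ lam) (hB : ∀ i, |x i| ≤ B)
    (hw : l2norm (w - D.mulVec x) ≤ η) (hz : ∀ i, |z i - x i| ≤ E)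
    (hz₀ : ∀ i, x i = 0 → |z i| ≤ κ) {θ : ℝ}
    (hθ : θ = mutualCoherence D * (lam * E + n * κ) + η) (hR : B + 2 * θ ≤ R) (i : Fin n) :
    |softThreshold f θ ((z + D.transpose.mulVec (w - D.mulVec z)) i) - x i| ≤
        q * E + (2 * mutualCoherence D * n * κ + 2 * η + κ) ∧
      (x i = 0 →
        |softThreshold f θ ((z + D.transpose.mulVec (w - D.mulVec z)) i)| ≤ κ) := by
  have hη : 0 ≤ η := (l2norm_nonneg _).trans hw
  have hμ := mutualCoherence_nonneg D
  have hlam : 0 ≤ lam := (Nat.cast_nonneg _).trans hx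
  have hu := hD.abs_gradient_step_sub_le hκ hw hz hz₀ i
  set u := (z + D.transpose.mulVec (w - D.mulVec z)) i
  set μ := mutualCoherence D
  have hθ₀ : 0 ≤ θ := by rw [hθ]; positivity
  have hcard : {j ∈ Finset.univ.erase i | x j ≠ 0} =
      ({j | x j ≠ 0} : Finset (Fin n)).erase i := by
    ext j; simp
  have hnorm : hammingNorm x = ({j | x j ≠ 0} : Finset (Fin n)).card := rfl
  have hle : (({j ∈ Finset.univ.erase i | x j ≠ 0} : Finset (Fin n)).card : ℝ) ≤ lam := by
    refine le_trans ?_ hx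
    rw [hcard, hnorm]
    exact_mod_cast Finset.card_erase_le
  -- The level `θ` is the worst-case error of the gradient step, so exact soft thresholding vanishes
  -- wherever `x` does.
  have huθ : |u - x i| ≤ θ := by
    rw [hθ]
    refine hu.trans ?_
    gcongr
  have happrox : |softThreshold f θ u - softThreshold relu θ u| ≤ κ := by
    refine abs_softThreshold_sub_relu_le hf ?_ hθ₀
    have : |u| ≤ |u - x i| + |x i| := by
      simpa using abs_add_le (u - x i) (x i)
    linarith [hB i]
  have hzero : x i = 0 → |softThreshold f θ u| ≤ κ := by
    intro h
    rw [h, sub_zero] at huθ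
    rwa [softThreshold_relu_eq_zero huθ, sub_zero] at happrox
  refine ⟨?_, hzero⟩
  by_cases h : x i = 0
  · rw [h, sub_zero]
    have := hzero h
    have : 0 ≤ q * E + 2 * μ * n * κ + 2 * η := by positivity
    linarith
  -- On the support, `i` is itself one of the nonzero entries, which leaves `lam - 1` others.
  -- Together with the `lam` in `θ` this gives the factor `2 * lam - 1`.
  · have hone : (({j ∈ Finset.univ.erase i | x j ≠ 0} : Finset (Fin n)).card : ℝ) ≤ lam - 1 := by
      have : ({j ∈ Finset.univ.erase i | x j ≠ 0} : Finset (Fin n)).card + 1 = hammingNorm x := by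
        rw [hcard, hnorm]
        exact Finset.card_erase_add_one (by simpa using h)
      have : (({j ∈ Finset.univ.erase i | x j ≠ 0} : Finset (Fin n)).card : ℝ) + 1 =
        hammingNorm x := by exact_mod_cast this
      linarith
    have hu' : |u - x i| ≤ μ * ((lam - 1) * E + n * κ) + η := by
      refine hu.trans ?_
      gcongr
    have h1 := abs_softThreshold_relu_sub_le hθ₀ u
    have h2 := mul_le_mul_of_nonneg_right hq hE
    have h3 : |softThreshold f θ u - x i| ≤ κ + θ + (μ * ((lam - 1) * E + n * κ) + η) := by
      have e : softThreshold f θ u - x i = (softThreshold f θ u - softThreshold relu θ u) +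
        (softThreshold relu θ u - u) + (u - x i) := by ring
      rw [e]
      exact (abs_add_three _ _ _).trans (by linarith)
    linarith

/-! ### Composition, parallel copies and thresholding layers. -/

namespace Network

/-- The composition of two networks. -/
def comp {n k : ℕ} (Ψ : Network n k) : {m : ℕ} → Network k m → Network n m
  | _, input => Ψ
  | _, linear Φ W b => (Ψ.comp Φ).linear W b
  | _, activated Φ W b => (Ψ.comp Φ).activated W b

lemma eval_comp (ρ : ℝ → ℝ) {n k m : ℕ} (Ψ : Network n k) (Φ : Network k m) (v : Fin n → ℝ) :
    (Ψ.comp Φ).eval ρ v = Φ.eval ρ (Ψ.eval ρ v) := by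
  induction Φ with
  | input => rfl
  | linear Φ W b ih => simp only [comp, eval, ih]
  | activated Φ W b ih => simp only [comp, eval, ih]

lemma depth_comp {n k m : ℕ} (Ψ : Network n k) (Φ : Network k m) :
    (Ψ.comp Φ).depth = Ψ.depth + Φ.depth := by
  induction Φ with
  | input => rfl
  | linear Φ W b ih => simp only [comp, depth, ih]; ring
  | activated Φ W b ih => simp only [comp, depth, ih]; ring

lemma numWeights_comp {n k m : ℕ} (Ψ : Network n k) (Φ : Network k m) :
    (Ψ.comp Φ).numWeights = Ψ.numWeights + Φ.numWeights := by
  induction Φ with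
  | input => rfl
  | linear Φ W b ih => simp only [comp, numWeights, ih]; ring
  | activated Φ W b ih => simp only [comp, numWeights, ih]; ring

lemma IsInitialSegment.comp {n l k m : ℕ} {Ψ : Network n l} {Φ : Network n k}
    (h : Ψ.IsInitialSegment Φ) (χ : Network k m) : Ψ.IsInitialSegment (Φ.comp χ) := by
  induction χ with
  | input => exact h
  | linear χ W b ih => exact ih.linear W b
  | activated χ W b ih => exact ih.activated W b

/-- `N` copies of the matrix `W` along the diagonal. -/
def copies (N : ℕ) {m k : ℕ} (W : Matrix (Fin m) (Fin k) ℝ) :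
    Matrix (Fin (N * m)) (Fin (N * k)) ℝ :=
  (Matrix.blockDiagonal fun _ : Fin N => W).submatrix
    (fun i => (finProdFinEquiv.symm i).swap) (fun i => (finProdFinEquiv.symm i).swap)

lemma copies_mulVec_apply {N m k : ℕ} (W : Matrix (Fin m) (Fin k) ℝ) (v : Fin (N * k) → ℝ)
    (a : Fin N) (i : Fin m) :
    (copies N W).mulVec v (finProdFinEquiv (a, i)) =
      W.mulVec (fun j => v (finProdFinEquiv (a, j))) i := by
  simp only [Matrix.mulVec, dotProduct]
  rw [← finProdFinEquiv.sum_comp, Fintype.sum_prod_type, Finset.sum_eq_single a]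
  · simp only [copies, Matrix.submatrix_apply, Equiv.symm_apply_apply, Prod.swap_prod_mk,
      Matrix.blockDiagonal_apply_eq]
  · intro b _ hb
    simp only [copies, Matrix.submatrix_apply, Equiv.symm_apply_apply, Prod.swap_prod_mk,
      Matrix.blockDiagonal_apply_ne _ _ _ hb.symm, zero_mul, Finset.sum_const_zero]
  · simp

/-- `N` parallel copies of the network `χ`, applied to the output of `Ψ`. -/
def parallel (N : ℕ) {r n : ℕ} (Ψ : Network r (N * n)) :
    {m : ℕ} → Network n m → Network r (N * m)
  | _, input => Ψ
  | _, linear χ W b => (parallel N Ψ χ).linear (copies N W) fun i => b (finProdFinEquiv.symm i).2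
  | _, activated χ W b =>
    (parallel N Ψ χ).activated (copies N W) fun i => b (finProdFinEquiv.symm i).2

lemma eval_parallel (ρ : ℝ → ℝ) (N : ℕ) {r n m : ℕ} (Ψ : Network r (N * n)) (χ : Network n m)
    (v : Fin r → ℝ) (a : Fin N) (i : Fin m) :
    (parallel N Ψ χ).eval ρ v (finProdFinEquiv (a, i)) =
      χ.eval ρ (fun j => Ψ.eval ρ v (finProdFinEquiv (a, j))) i := by
  induction χ with
  | input => rfl
  | linear χ W b ih =>
    simp only [parallel, eval, Pi.add_apply, copies_mulVec_apply, ih, Equiv.symm_apply_apply]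
  | activated χ W b ih =>
    simp only [parallel, eval, Pi.add_apply, copies_mulVec_apply, ih, Equiv.symm_apply_apply]

lemma depth_parallel (N : ℕ) {r n m : ℕ} (Ψ : Network r (N * n)) (χ : Network n m) :
    (parallel N Ψ χ).depth = Ψ.depth + χ.depth := by
  induction χ with
  | input => rfl
  | linear χ W b ih => simp only [parallel, depth, ih]; ring
  | activated χ W b ih => simp only [parallel, depth, ih]; ring

/-- The zeros of the block diagonal matrices count as weights, whence `N ^ 2`. -/
lemma numWeights_parallel_le (N : ℕ) {r n m : ℕ} (Ψ : Network r (N * n)) (χ : Network n m) :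
    (parallel N Ψ χ).numWeights ≤ Ψ.numWeights + N ^ 2 * χ.numWeights := by
  have hN : N ≤ N ^ 2 := Nat.le_self_pow two_ne_zero N
  induction χ with
  | input => simp [parallel, numWeights]
  | @linear k m χ W b ih =>
    simp only [parallel, numWeights]
    nlinarith [Nat.mul_le_mul_right m hN]
  | @activated k m χ W b ih =>
    simp only [parallel, numWeights]
    nlinarith [Nat.mul_le_mul_right m hN]

/-- The coordinates of the layer that feeds two copies of a network for each of `p` inputs. -/
def pairEquiv (p : ℕ) : Fin p ⊕ Fin p ≃ Fin ((p + p) * 1) :=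
  finSumFinEquiv.trans ((Equiv.prodUnique _ (Fin 1)).symm.trans finProdFinEquiv)

/-- Multiplication by `G`, followed by thresholding in every coordinate. -/
noncomputable def threshold {r p : ℕ} (Ψ : Network r p) (φ : Network 1 1) (L : ℝ)
    (G : Matrix (Fin p) (Fin p) ℝ) (θ : Fin p → ℝ) : Network r p :=
  (parallel (p + p)
    (Ψ.linear ((Matrix.fromRows (L • G) (-(L • G))).submatrix (pairEquiv p).symm id)
      (Sum.elim (-(L • θ)) (-(L • θ)) ∘ (pairEquiv p).symm)) φ).linear
    ((Matrix.fromCols (L⁻¹ • 1) (-(L⁻¹ • 1))).submatrix id (pairEquiv p).symm) 0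

/-- The two copies of `φ` receive `L (G u - θ)` and `L (-G u - θ)`; the last layer subtracts their
outputs and divides by `L`. -/
lemma eval_threshold (ρ : ℝ → ℝ) {r p : ℕ} (Ψ : Network r p) (φ : Network 1 1) (L : ℝ)
    (G : Matrix (Fin p) (Fin p) ℝ) (θ : Fin p → ℝ) (v : Fin r → ℝ) (i : Fin p) :
    (threshold Ψ φ L G θ).eval ρ v i =
      softThreshold (fun t => L⁻¹ * φ.eval ρ (fun _ => L * t) 0) (θ i)
        (G.mulVec (Ψ.eval ρ v) i) := by
  have key : ∀ (Φ : Network r ((p + p) * 1)) (a : Fin p ⊕ Fin p),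
      (parallel (p + p) Φ φ).eval ρ v (pairEquiv p a) =
        φ.eval ρ (fun _ => Φ.eval ρ v (pairEquiv p a)) 0 := by
    intro Φ a
    have := eval_parallel ρ (p + p) Φ φ v (finSumFinEquiv a) 0
    simp only [Subsingleton.elim _ (0 : Fin 1)] at this
    exact this
  simp only [threshold, eval, add_zero]
  have hrow : ∀ (W : Matrix (Fin p ⊕ Fin p) (Fin p) ℝ) (u : Fin p → ℝ) (a : Fin p ⊕ Fin p),
      (W.submatrix (pairEquiv p).symm id).mulVec u (pairEquiv p a) = W.mulVec u a := by
    intro W u a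
    simp [Matrix.mulVec, dotProduct]
  rw [Matrix.submatrix_mulVec_equiv]
  simp only [Equiv.symm_symm, Function.comp_def, key, eval, Pi.add_apply, hrow,
    Equiv.symm_apply_apply, Matrix.fromCols_mulVec, Matrix.fromRows_mulVec, Sum.elim_inl,
    Sum.elim_inr, id, Matrix.neg_mulVec, Matrix.smul_mulVec, Matrix.one_mulVec, Pi.neg_apply,
    Pi.smul_apply, smul_eq_mul, softThreshold]
  rw [sub_eq_add_neg, mul_sub, mul_sub, mul_neg]
  simp only [sub_eq_add_neg]

lemma depth_threshold {r p : ℕ} (Ψ : Network r p) (φ : Network 1 1) (L : ℝ)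
    (G : Matrix (Fin p) (Fin p) ℝ) (θ : Fin p → ℝ) :
    (threshold Ψ φ L G θ).depth = Ψ.depth + (φ.depth + 2) := by
  simp only [threshold, depth, depth_parallel]; ring

lemma numWeights_threshold_le {r p : ℕ} (Ψ : Network r p) (φ : Network 1 1) (L : ℝ)
    (G : Matrix (Fin p) (Fin p) ℝ) (θ : Fin p → ℝ) :
    (threshold Ψ φ L G θ).numWeights ≤
      Ψ.numWeights + (4 * p ^ 2 + 3 * p) * (φ.numWeights + 1) := by
  have := numWeights_parallel_le (p + p)
    (Ψ.linear ((Matrix.fromRows (L • G) (-(L • G))).submatrix (pairEquiv p).symm id)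
      (Sum.elim (-(L • θ)) (-(L • θ)) ∘ (pairEquiv p).symm)) φ
  simp only [threshold, numWeights] at this ⊢
  nlinarith [Nat.zero_le (p * φ.numWeights)]

end Network

/-! ### The unrolled iteration as a network. -/

namespace Network

/-- The linear part of a step of iterative thresholding, which keeps the data `w` next to the
iterate `z`. -/
noncomputable def gradientMatrix {m n : ℕ} (D : Matrix (Fin m) (Fin n) ℝ) :
    Matrix (Fin (n + m)) (Fin (n + m)) ℝ :=
  (Matrix.fromBlocks (1 - D.transpose * D) D.transpose 0 1).submatrix
    finSumFinEquiv.symm finSumFinEquiv.symm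

lemma gradientMatrix_mulVec_inl {m n : ℕ} (D : Matrix (Fin m) (Fin n) ℝ) (u : Fin (n + m) → ℝ)
    (i : Fin n) :
    (gradientMatrix D).mulVec u (finSumFinEquiv (Sum.inl i)) =
      ((fun i => u (finSumFinEquiv (Sum.inl i))) + D.transpose.mulVec
        ((fun i => u (finSumFinEquiv (Sum.inr i))) -
          D.mulVec fun i => u (finSumFinEquiv (Sum.inl i)))) i := by
  rw [gradientMatrix, Matrix.submatrix_mulVec_equiv, Function.comp_apply,
    Equiv.symm_apply_apply, Equiv.symm_symm, Matrix.fromBlocks_mulVec, Sum.elim_inl,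
    Matrix.sub_mulVec, Matrix.one_mulVec, Matrix.mulVec_sub, Matrix.mulVec_mulVec]
  simp only [Pi.add_apply, Pi.sub_apply, Function.comp_def]
  ring

lemma gradientMatrix_mulVec_inr {m n : ℕ} (D : Matrix (Fin m) (Fin n) ℝ) (u : Fin (n + m) → ℝ)
    (i : Fin m) :
    (gradientMatrix D).mulVec u (finSumFinEquiv (Sum.inr i)) =
      u (finSumFinEquiv (Sum.inr i)) := by
  rw [gradientMatrix, Matrix.submatrix_mulVec_equiv, Function.comp_apply,
    Equiv.symm_apply_apply, Equiv.symm_symm, Matrix.fromBlocks_mulVec, Sum.elim_inr,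
    Matrix.zero_mulVec, Matrix.one_mulVec, zero_add]
  rfl

/-- `k` steps of iterative thresholding for the dictionary `D` with thresholds `θ`. -/
noncomputable def thresholdingState {m n : ℕ} (D : Matrix (Fin m) (Fin n) ℝ) (φ : Network 1 1)
    (L : ℝ) (θ : ℕ → ℝ) : ℕ → Network m (n + m)
  | 0 => input.linear
      ((Matrix.fromRows (0 : Matrix (Fin n) (Fin m) ℝ) 1).submatrix finSumFinEquiv.symm id) 0
  -- The data coordinates get threshold 0, so they pass unchanged up to the error of `φ`.
  | k + 1 => threshold (thresholdingState D φ L θ k) φ L (gradientMatrix D)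
      (Sum.elim (fun _ => θ k) 0 ∘ finSumFinEquiv.symm)

/-- The iterate that is computed by `thresholdingState`. -/
noncomputable def thresholding {m n : ℕ} (D : Matrix (Fin m) (Fin n) ℝ) (φ : Network 1 1)
    (L : ℝ) (θ : ℕ → ℝ) (k : ℕ) : Network m n :=
  (thresholdingState D φ L θ k).linear
    ((Matrix.fromCols 1 (0 : Matrix (Fin n) (Fin m) ℝ)).submatrix id finSumFinEquiv.symm) 0

lemma eval_thresholding (ρ : ℝ → ℝ) {m n : ℕ} (D : Matrix (Fin m) (Fin n) ℝ) (φ : Network 1 1)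
    (L : ℝ) (θ : ℕ → ℝ) (k : ℕ) (v : Fin m → ℝ) :
    (thresholding D φ L θ k).eval ρ v =
      fun i => (thresholdingState D φ L θ k).eval ρ v (finSumFinEquiv (Sum.inl i)) := by
  rw [thresholding, eval, add_zero, Matrix.submatrix_mulVec_equiv, Matrix.fromCols_mulVec,
    Matrix.zero_mulVec, Matrix.one_mulVec, add_zero]
  rfl

lemma eval_thresholdingState_zero (ρ : ℝ → ℝ) {m n : ℕ} (D : Matrix (Fin m) (Fin n) ℝ)
    (φ : Network 1 1) (L : ℝ) (θ : ℕ → ℝ) (v : Fin m → ℝ) (a : Fin n ⊕ Fin m) :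
    (thresholdingState D φ L θ 0).eval ρ v (finSumFinEquiv a) = Sum.elim (fun _ => (0 : ℝ)) v a := by
  have hrow : ∀ W : Matrix (Fin n ⊕ Fin m) (Fin m) ℝ,
      (W.submatrix finSumFinEquiv.symm id).mulVec v (finSumFinEquiv a) = W.mulVec v a := by
    intro W
    simp only [Matrix.mulVec, dotProduct, Matrix.submatrix_apply, Equiv.symm_apply_apply, id]
  rw [thresholdingState, eval, add_zero, eval, hrow, Matrix.fromRows_mulVec, Matrix.zero_mulVec,
    Matrix.one_mulVec]
  rfl

lemma depth_thresholding {m n : ℕ} (D : Matrix (Fin m) (Fin n) ℝ) (φ : Network 1 1)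
    (L : ℝ) (θ : ℕ → ℝ) (k : ℕ) :
    (thresholding D φ L θ k).depth = k * (φ.depth + 2) + 2 := by
  have : (thresholdingState D φ L θ k).depth = k * (φ.depth + 2) + 1 := by
    induction k with
    | zero => simp [thresholdingState, depth]
    | succ k ih => rw [thresholdingState, depth_threshold, ih]; ring
  rw [thresholding, depth, this]

lemma numWeights_thresholding_le {m n : ℕ} (D : Matrix (Fin m) (Fin n) ℝ) (φ : Network 1 1)
    (L : ℝ) (θ : ℕ → ℝ) (k : ℕ) :
    (thresholding D φ L θ k).numWeights ≤
      k * ((4 * (n + m) ^ 2 + 3 * (n + m)) * (φ.numWeights + 1)) +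
        2 * ((n + m) ^ 2 + (n + m)) := by
  have : (thresholdingState D φ L θ k).numWeights ≤
      k * ((4 * (n + m) ^ 2 + 3 * (n + m)) * (φ.numWeights + 1)) +
        ((n + m) * m + (n + m)) := by
    induction k with
    | zero => simp [thresholdingState, numWeights]
    | succ k ih =>
      rw [thresholdingState]
      refine (numWeights_threshold_le _ _ _ _ _).trans ?_
      linarith
  simp only [thresholding, numWeights]
  nlinarith [Nat.zero_le (n * m), Nat.zero_le (n * n), Nat.zero_le (m * m)]

/-- A bound for the size of a thresholding network, relative to that of its building block. -/
def thresholdingCost (m n : ℕ) : ℕ := 6 * (n + m) ^ 2 + 5 * (n + m) + 4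

lemma depth_thresholding_le {m n : ℕ} (D : Matrix (Fin m) (Fin n) ℝ) (φ : Network 1 1)
    (L : ℝ) (θ : ℕ → ℝ) {k : ℕ} (hk : 1 ≤ k) :
    (thresholding D φ L θ k).depth ≤ thresholdingCost m n * k * (φ.depth + 1) := by
  rw [depth_thresholding]
  calc _ ≤ 4 * (k * (φ.depth + 1)) := by nlinarith [Nat.zero_le (k * φ.depth)]
    _ ≤ thresholdingCost m n * (k * (φ.depth + 1)) :=
      Nat.mul_le_mul_right _ (by simp [thresholdingCost])
    _ = _ := by ring

lemma numWeights_thresholding_le_cost {m n : ℕ} (D : Matrix (Fin m) (Fin n) ℝ)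
    (φ : Network 1 1) (L : ℝ) (θ : ℕ → ℝ) {k : ℕ} (hk : 1 ≤ k) :
    (thresholding D φ L θ k).numWeights ≤ thresholdingCost m n * k * (φ.numWeights + 1) := by
  have h : 1 ≤ k * (φ.numWeights + 1) := Nat.one_le_iff_ne_zero.mpr (by positivity)
  refine (numWeights_thresholding_le D φ L θ k).trans ?_
  calc _ ≤ (4 * (n + m) ^ 2 + 3 * (n + m)) * (k * (φ.numWeights + 1)) +
        2 * ((n + m) ^ 2 + (n + m)) * (k * (φ.numWeights + 1)) := by
        refine Nat.add_le_add (le_of_eq (by ring)) (Nat.le_mul_of_pos_right _ h)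
    _ ≤ _ := by
        rw [thresholdingCost]
        nlinarith

end Network

/-! ### Convergence of the iteration with inexact activations. -/

open Network in
/-- The error of iterative thresholding after `k` steps. -/
lemma ColumnNormalized.thresholding_error {m n : ℕ} {D : Matrix (Fin m) (Fin n) ℝ}
    (hD : ColumnNormalized D) {lam q : ℝ} (hq₀ : 0 ≤ q) (hq₁ : q < 1)
    (hq : mutualCoherence D * (2 * lam - 1) ≤ q) {ρ : ℝ → ℝ} {φ : Network 1 1}
    {L R κ h B η s : ℝ} {K : ℕ}
    (hf : ∀ t, |t| ≤ R → |L⁻¹ * φ.eval ρ (fun _ => L * t) 0 - relu t| ≤ κ / 2) (hκ : 0 ≤ κ)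
    {x : Fin n → ℝ} {v : Fin m → ℝ} (hx : (hammingNorm x : ℝ) ≤ lam) (hB₀ : 0 ≤ B)
    (hB : ∀ i, |x i| ≤ B) (hv : l2norm (v - D.mulVec x) ≤ h) (hη : η = h + m * (K * κ))
    (hs : s = 2 * mutualCoherence D * n * κ + 2 * η + κ)
    (hR : B + 2 * (mutualCoherence D * (lam * (B + s / (1 - q)) + n * κ) + η) ≤ R)
    (hvR : ∀ i, |v i| + K * κ ≤ R) {θ : ℕ → ℝ}
    (hθ : ∀ k, θ k = mutualCoherence D * (lam * (q ^ k * B + s / (1 - q)) + n * κ) + η)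
    (i : Fin n) :
    |(thresholding D φ L θ K).eval ρ v i - x i| ≤ q ^ K * B + s / (1 - q) := by
  have hμ := mutualCoherence_nonneg D
  have hlam : 0 ≤ lam := (Nat.cast_nonneg _).trans hx
  have hh : 0 ≤ h := (l2norm_nonneg _).trans hv
  have hη₀ : 0 ≤ η := by rw [hη]; positivity
  have hs₀ : 0 ≤ s := by rw [hs]; positivity
  have hr₀ : 0 ≤ s / (1 - q) := div_nonneg hs₀ (by linarith)
  -- `s / (1 - q)` is the fixed point of `E ↦ q E + s`, so errors `q ^ k * B + s / (1 - q)`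
  -- reproduce themselves.
  have hsq : q * (s / (1 - q)) + s = s / (1 - q) := by
    have : 1 - q ≠ 0 := by linarith
    field_simp
    ring
  -- The invariant couples the maximal error, near-vanishing off the support, and the drift of the
  -- carried data.
  have main : ∀ k ≤ K,
      (∀ i, |(thresholdingState D φ L θ k).eval ρ v (finSumFinEquiv (Sum.inl i)) - x i| ≤
          q ^ k * B + s / (1 - q)) ∧
      (∀ i, x i = 0 →
        |(thresholdingState D φ L θ k).eval ρ v (finSumFinEquiv (Sum.inl i))| ≤ κ) ∧
      (∀ i, |(thresholdingState D φ L θ k).eval ρ v (finSumFinEquiv (Sum.inr i)) - v i| ≤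
          k * κ) := by
    intro k
    induction k with
    | zero =>
      intro _
      simp only [eval_thresholdingState_zero, Sum.elim_inl, Sum.elim_inr, zero_sub,
        abs_neg, sub_self, abs_zero, pow_zero, one_mul, Nat.cast_zero, zero_mul]
      exact ⟨fun i => by linarith [hB i], fun _ _ => hκ, fun _ => le_rfl⟩
    | succ k ih =>
      intro hk
      obtain ⟨h1, h2, h3⟩ := ih (by omega)
      have hkK : ((k : ℝ) + 1) * κ ≤ K * κ := by
        gcongr
        exact_mod_cast hk
      -- The drift of the data acts as additional noise, which is the term `m * (K * κ)` in `η`.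
      have hw : l2norm ((fun i => (thresholdingState D φ L θ k).eval ρ v
          (finSumFinEquiv (Sum.inr i))) - D.mulVec x) ≤ η := by
        have e := l2norm_add_le ((fun i => (thresholdingState D φ L θ k).eval ρ v
          (finSumFinEquiv (Sum.inr i))) - v) (v - D.mulVec x)
        rw [sub_add_sub_cancel] at e
        have e' := l2norm_le_of_abs_le (v := (fun i => (thresholdingState D φ L θ k).eval ρ v
          (finSumFinEquiv (Sum.inr i))) - v) h3
        have e'' : (m : ℝ) * (k * κ) ≤ m * (K * κ) := by
          gcongr
          omega
        rw [hη]
        linarith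
      have hθR : B + 2 * θ k ≤ R := by
        refine le_trans ?_ hR
        rw [hθ]
        have : q ^ k * B ≤ B := mul_le_of_le_one_left hB₀ (pow_le_one₀ hq₀ hq₁.le)
        gcongr
      have hE : 0 ≤ q ^ k * B + s / (1 - q) := by positivity
      have hstep := hD.thresholding_step hq₀ hq hf hκ hE hx hB hw h1 h2 (hθ k) hθR
      refine ⟨fun i => ?_, fun i hi => ?_, fun i => ?_⟩
      · rw [thresholdingState, eval_threshold, gradientMatrix_mulVec_inl, Function.comp_apply,
          Equiv.symm_apply_apply, Sum.elim_inl]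
        refine (hstep i).1.trans (le_of_eq ?_)
        rw [← hs, pow_succ]
        linarith
      · rw [thresholdingState, eval_threshold, gradientMatrix_mulVec_inl, Function.comp_apply,
          Equiv.symm_apply_apply, Sum.elim_inl]
        exact (hstep i).2 hi
      · rw [thresholdingState, eval_threshold, gradientMatrix_mulVec_inr, Function.comp_apply,
          Equiv.symm_apply_apply, Sum.elim_inr, Pi.zero_apply]
        have h3i := h3 i
        set w := (thresholdingState D φ L θ k).eval ρ v (finSumFinEquiv (Sum.inr i))
        have hwR : |w| + 0 ≤ R := by
          have : |w| ≤ |w - v i| + |v i| := by simpa using abs_add_le (w - v i) (v i)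
          linarith [hvR i]
        have e1 := abs_softThreshold_sub_relu_le hf hwR le_rfl
        have e2 := abs_softThreshold_relu_sub_le le_rfl w
        have e3 := abs_add_three
          (softThreshold (fun t => L⁻¹ * φ.eval ρ (fun _ => L * t) 0) 0 w - softThreshold relu 0 w)
          (softThreshold relu 0 w - w) (w - v i)
        rw [sub_add_sub_cancel, sub_add_sub_cancel] at e3
        push_cast
        linarith
  rw [eval_thresholding]
  exact (main K le_rfl).1 i

/-! ### Rescaled activations and recovery for one dictionary. -/

lemma relu_mul {a : ℝ} (ha : 0 ≤ a) (t : ℝ) : relu (a * t) = a * relu t := by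
  rw [relu, relu, mul_max_of_nonneg _ _ ha, mul_zero]

lemma ApproximatesReLU.nonneg {ρ : ℝ → ℝ} {φ : Network 1 1} {M ε : ℝ}
    (h : ApproximatesReLU ρ φ M ε) (hM : 0 ≤ M) : 0 ≤ ε :=
  (abs_nonneg _).trans (h 0 ⟨by linarith, hM⟩)

/-- Rescaling makes the approximation of the rectified linear unit more accurate. -/
lemma ApproximatesReLU.rescale {ρ : ℝ → ℝ} {φ : Network 1 1} {M ε L R : ℝ}
    (h : ApproximatesReLU ρ φ M ε) (hL : 0 < L) (hM : L * R ≤ M) {t : ℝ} (ht : |t| ≤ R) :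
    |L⁻¹ * φ.eval ρ (fun _ => L * t) 0 - relu t| ≤ ε / L := by
  have hLt : |L * t| ≤ M := by
    rw [abs_mul, abs_of_pos hL]
    exact (mul_le_mul_of_nonneg_left ht hL.le).trans hM
  have h1 := h (L * t) (abs_le.mp hLt)
  rw [relu_mul hL.le] at h1
  have e : L⁻¹ * φ.eval ρ (fun _ => L * t) 0 - relu t =
      L⁻¹ * (φ.eval ρ (fun _ => L * t) 0 - L * relu t) := by
    field_simp
  rw [e, abs_mul, abs_of_pos (inv_pos.mpr hL), div_eq_inv_mul]
  exact mul_le_mul_of_nonneg_left h1 (inv_pos.mpr hL).le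

/-- A crude bound suffices: it only enters the size of the interval on which `φ` must approximate
ReLU. -/
lemma abs_mulVec_le {m n : ℕ} (D : Matrix (Fin m) (Fin n) ℝ) {x : Fin n → ℝ} {B : ℝ}
    (hB : ∀ i, |x i| ≤ B) (i : Fin m) : |D.mulVec x i| ≤ (∑ i, ∑ j, |D i j|) * |B| := by
  calc |D.mulVec x i| ≤ ∑ j, |D i j * x j| := by
        rw [Matrix.mulVec, dotProduct]
        exact Finset.abs_sum_le_sum_abs _ _
    _ ≤ ∑ j, |D i j| * |B| := by
        refine Finset.sum_le_sum fun j _ => ?_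
        rw [abs_mul]
        exact mul_le_mul_of_nonneg_left ((hB j).trans (le_abs_self B)) (abs_nonneg _)
    _ = (∑ j, |D i j|) * |B| := (Finset.sum_mul _ _ _).symm
    _ ≤ _ := by
        refine mul_le_mul_of_nonneg_right ?_ (abs_nonneg _)
        exact Finset.single_le_sum (f := fun i => ∑ j, |D i j|)
          (fun i _ => Finset.sum_nonneg fun j _ => abs_nonneg _) (Finset.mem_univ i)

/-- Networks that recover sparse vectors from noisy measurements by one dictionary. -/
lemma ColumnNormalized.exists_recovery {m n : ℕ} {D : Matrix (Fin m) (Fin n) ℝ}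
    (hD : ColumnNormalized D) {lam q : ℝ} (hq₀ : 0 ≤ q) (hq₁ : q < 1)
    (hq : mutualCoherence D * (2 * lam - 1) ≤ q) (B : ℝ) :
    ∃ C : ℝ, ∀ K : ℕ, 1 ≤ K → ∀ H : ℝ, 0 ≤ H → ∃ M₀ : ℝ, 0 ≤ M₀ ∧ ∀ M : ℝ, M₀ ≤ M →
      ∀ (ρ : ℝ → ℝ) (φ : Network 1 1) (ε : ℝ), ApproximatesReLU ρ φ M ε →
      ∀ h : ℝ, 0 ≤ h → (ε ≤ 1 → h ≤ H) →
      ∃ S : Network m n, S.depth ≤ Network.thresholdingCost m n * K * (φ.depth + 1) ∧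
        S.numWeights ≤ Network.thresholdingCost m n * K * (φ.numWeights + 1) ∧
        ∀ (x : Fin n → ℝ) (v : Fin m → ℝ), (hammingNorm x : ℝ) ≤ lam → (∀ i, |x i| ≤ B) →
          l2norm (v - D.mulVec x) ≤ h → l2norm (S.eval ρ v - x) ≤ C * (q ^ K + h + ε) := by
  have hμ := mutualCoherence_nonneg D
  set μ := mutualCoherence D
  have hq' : 0 < 1 - q := by linarith
  -- Chosen so that `s ≤ a * (h + ε)` once `κ ≤ 2 * ε` and `K * κ = 2 * ε`.
  set a : ℝ := 4 * μ * n + 4 * m + 2 with ha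
  have ha₀ : 0 ≤ a := by positivity
  set T : ℝ := (∑ i, ∑ j, |D i j|) * |B|
  have hT : 0 ≤ T :=
    mul_nonneg (Finset.sum_nonneg fun i _ => Finset.sum_nonneg fun j _ => abs_nonneg _)
      (abs_nonneg _)
  refine ⟨n * (|B| + a / (1 - q)), fun K hK H hH => ?_⟩
  -- The first two summands bound the thresholding arguments, the last bracket the carried data, all
  -- for `ε ≤ 1` and `h ≤ H`.
  set R : ℝ := |B| + 2 * (μ * (|lam| * (|B| + a * (H + 1) / (1 - q)) + n * 2) + (H + m * 2)) +
    (T + H + 2) with hRdef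
  have hK₀ : (1 : ℝ) ≤ K := by exact_mod_cast hK
  refine ⟨K * R, by positivity, fun M hM ρ φ ε hφ h hh hhH => ?_⟩
  have hε : 0 ≤ ε := hφ.nonneg (le_trans (by positivity) hM)
  have hq_pow : 0 ≤ q ^ K := pow_nonneg hq₀ K
  -- `M₀` must not depend on `ε`. For `ε > 1` the zero network will do, since its error `n * |B|` is
  -- absorbed by `C * ε`.
  by_cases hε₁ : ε ≤ 1
  · have hhH := hhH hε₁
    -- Scaling by `L = K` gives error `ε / K` for each of the two activations of a threshold.
    set κ : ℝ := 2 * (ε / K) with hκ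
    have hκ₀ : 0 ≤ κ := by positivity
    have hKκ : K * κ = 2 * ε := by
      rw [hκ]; field_simp
    have hκε : κ ≤ 2 * ε := by
      rw [hκ]
      have := div_le_self hε hK₀
      linarith
    set η : ℝ := h + m * (K * κ) with hη
    set s : ℝ := 2 * μ * n * κ + 2 * η + κ with hs
    have hs₁ : s ≤ a * (h + ε) := by
      have e1 : 2 * μ * n * κ ≤ 2 * μ * n * (2 * ε) := by gcongr
      have e2 : 2 * h ≤ a * h := by
        refine mul_le_mul_of_nonneg_right ?_ hh
        rw [ha]
        have : 0 ≤ 4 * μ * n + 4 * m := by positivity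
        linarith
      have e3 : a * ε = 2 * μ * n * (2 * ε) + 2 * (m * (2 * ε)) + 2 * ε := by rw [ha]; ring
      rw [hs, hη, hKκ]
      linarith
    refine ⟨Network.thresholding D φ K
      (fun k => μ * (lam * (q ^ k * |B| + s / (1 - q)) + n * κ) + η) K,
      Network.depth_thresholding_le _ _ _ _ hK,
      Network.numWeights_thresholding_le_cost _ _ _ _ hK, fun x v hx hB hv => ?_⟩
    have hlam : 0 ≤ lam := (Nat.cast_nonneg _).trans hx
    have hη₁ : η ≤ H + m * 2 := by
      rw [hη, hKκ]
      gcongr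
      linarith
    have hκ₁ : κ ≤ 2 := by linarith
    have hR₁ : |B| + 2 * (μ * (lam * (|B| + s / (1 - q)) + n * κ) + η) ≤ R := by
      have e1 : s / (1 - q) ≤ a * (H + 1) / (1 - q) := by
        refine div_le_div_of_nonneg_right (hs₁.trans ?_) hq'.le
        gcongr
      have e2 : |B| + 2 * (μ * (lam * (|B| + s / (1 - q)) + n * κ) + η) ≤
          |B| + 2 * (μ * (|lam| * (|B| + a * (H + 1) / (1 - q)) + n * 2) + (H + m * 2)) := by
        rw [abs_of_nonneg hlam]
        gcongr
      linarith
    have hR₂ : ∀ i, |v i| + K * κ ≤ R := by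
      intro i
      have e1 := abs_mulVec_le D hB i
      have e2 := (abs_apply_le_l2norm _ i).trans hv
      have e3 : |v i| ≤ |(v - D.mulVec x) i| + |D.mulVec x i| := by
        simpa using abs_add_le ((v - D.mulVec x) i) (D.mulVec x i)
      have e4 : 0 ≤ |B| +
          2 * (μ * (|lam| * (|B| + a * (H + 1) / (1 - q)) + n * 2) + (H + m * 2)) := by
        positivity
      linarith
    have hf : ∀ t, |t| ≤ R →
        |(K : ℝ)⁻¹ * φ.eval ρ (fun _ => (K : ℝ) * t) 0 - relu t| ≤ κ / 2 := by
      intro t ht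
      refine (hφ.rescale (by linarith) hM ht).trans (le_of_eq ?_)
      rw [hκ]; ring
    have key := hD.thresholding_error hq₀ hq₁ hq hf hκ₀ hx (abs_nonneg B)
      (fun i => (hB i).trans (le_abs_self B)) hv hη hs hR₁ hR₂ (fun _ => rfl)
    refine (l2norm_le_of_abs_le key).trans ?_
    rw [mul_assoc]
    refine mul_le_mul_of_nonneg_left ?_ (Nat.cast_nonneg n)
    have e1 : s / (1 - q) ≤ a / (1 - q) * (h + ε) := by
      rw [div_mul_eq_mul_div]
      exact div_le_div_of_nonneg_right hs₁ hq'.le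
    have e2 : 0 ≤ |B| * (h + ε) := by positivity
    have e3 : 0 ≤ a / (1 - q) * q ^ K := by positivity
    linarith
  · refine ⟨Network.input.linear 0 0, ?_, ?_, fun x v _ hB _ => ?_⟩
    · have : 1 ≤ Network.thresholdingCost m n * K * (φ.depth + 1) :=
        Nat.one_le_iff_ne_zero.mpr (by simp [Network.thresholdingCost]; omega)
      simpa [Network.depth] using this
    · have h1 : 1 ≤ K * (φ.numWeights + 1) := Nat.one_le_iff_ne_zero.mpr (by positivity)
      calc (Network.input.linear (0 : Matrix (Fin n) (Fin m) ℝ) 0).numWeights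
          ≤ Network.thresholdingCost m n := by
            simp only [Network.numWeights, Network.thresholdingCost]
            nlinarith [Nat.zero_le (n * m), Nat.zero_le (n * n), Nat.zero_le (m * m)]
        _ ≤ Network.thresholdingCost m n * (K * (φ.numWeights + 1)) :=
            Nat.le_mul_of_pos_right _ h1
        _ = _ := by ring
    · have e : l2norm ((Network.input.linear (0 : Matrix (Fin n) (Fin m) ℝ) 0).eval ρ v - x) ≤
          n * |B| := by
        refine l2norm_le_of_abs_le fun i => ?_
        simpa [Network.eval] using (hB i).trans (le_abs_self B)
      refine e.trans ?_
      rw [mul_assoc]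
      refine mul_le_mul_of_nonneg_left ?_ (Nat.cast_nonneg n)
      have e1 : |B| * 1 ≤ |B| * (q ^ K + h + ε) := by
        gcongr
        linarith
      have e2 : 0 ≤ a / (1 - q) * (q ^ K + h + ε) := by positivity
      linarith

/-! ### Chaining the layers; the contraction factor. -/

lemma eq_sum_of_forall_succ {J : ℕ} {f : Fin (J + 1) → ℕ} {g : Fin J → ℕ} (h₀ : f 0 = 0)
    (hs : ∀ j, f j.succ = f j.castSucc + g j) : f (Fin.last J) = ∑ j, g j := by
  induction J with
  | zero => simpa using h₀
  | succ J ih =>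
    rw [Fin.sum_univ_castSucc, ← Fin.succ_last, hs,
      ih (f := fun j => f j.castSucc) (g := fun j => g j.castSucc) h₀
        fun j => by rw [← Fin.succ_castSucc, hs]]

/-- The networks `S₁, …, S_J` in succession, with all intermediate results. -/
lemma Network.exists_chain {J : ℕ} {d : Fin (J + 1) → ℕ}
    (S : (j : Fin J) → Network (d j.castSucc) (d j.succ)) :
    ∃ Ψ : (j : Fin (J + 1)) → Network (d 0) (d j), (∀ ρ v, (Ψ 0).eval ρ v = v) ∧
      (∀ j ρ v, (Ψ j.succ).eval ρ v = (S j).eval ρ ((Ψ j.castSucc).eval ρ v)) ∧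
      (∀ j, (Ψ j).IsInitialSegment (Ψ (Fin.last J))) ∧
      (Ψ (Fin.last J)).depth = ∑ j, (S j).depth ∧
      (Ψ (Fin.last J)).numWeights = ∑ j, (S j).numWeights := by
  let Ψ : (j : Fin (J + 1)) → Network (d 0) (d j) :=
    Fin.induction input fun j Φ => Φ.comp (S j)
  have h₀ : Ψ 0 = input := rfl
  have hs : ∀ j : Fin J, Ψ j.succ = (Ψ j.castSucc).comp (S j) := fun j => Fin.induction_succ ..
  have hseg : ∀ k j : Fin (J + 1), j ≤ k → (Ψ j).IsInitialSegment (Ψ k) := by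
    intro k
    induction k using Fin.induction with
    | zero =>
      intro j hj
      rw [Fin.le_zero_iff.mp hj]
      exact .refl
    | succ k ih =>
      intro j hj
      rcases hj.eq_or_lt with h | h
      · rw [h]
        exact .refl
      · rw [hs]
        exact (ih j (Fin.le_castSucc_iff.mpr h)).comp (S k)
  refine ⟨Ψ, fun ρ v => ?_, fun j ρ v => ?_, fun j => hseg _ j (Fin.le_last j), ?_, ?_⟩
  · rw [h₀, eval]
  · rw [hs, eval_comp]
  · refine eq_sum_of_forall_succ (f := fun j => (Ψ j).depth) (by simp [h₀, depth]) fun j => ?_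
    simp only [hs, depth_comp]
  · refine eq_sum_of_forall_succ (f := fun j => (Ψ j).numWeights) (by simp [h₀, numWeights])
      fun j => ?_
    simp only [hs, numWeights_comp]

/-- The uniqueness condition provides a common contraction factor of all layers. -/
lemma UniquenessCondition.exists_factor {J : ℕ} {d : Fin (J + 1) → ℕ} {D : Dictionaries d}
    {lam : Fin J → ℝ} (h : UniquenessCondition D lam) :
    ∃ q : ℝ, 0 < q ∧ q < 1 ∧ ∀ j, mutualCoherence (D j) * (2 * lam j - 1) ≤ q := by
  have hlt : ∀ j, mutualCoherence (D j) * (2 * lam j - 1) < 1 := by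
    intro j
    rcases (mutualCoherence_nonneg (D j)).eq_or_lt with h0 | h0
    · rw [← h0, zero_mul]
      exact one_pos
    · have h1 := h j h0
      have h2 : 2 * lam j - 1 < 1 / mutualCoherence (D j) := by linarith
      rwa [lt_div_iff₀ h0, mul_comm] at h2
  -- Finitely many strict inequalities leave room for one `q < 1`; it is also taken positive, so
  -- that `log q` can serve as a rate.
  have hev : ∀ᶠ q in nhdsWithin (1 : ℝ) (Set.Iio 1),
      ∀ j, mutualCoherence (D j) * (2 * lam j - 1) ≤ q :=
    Filter.eventually_all.mpr fun j =>
      Filter.mem_of_superset (Ioo_mem_nhdsLT (hlt j)) fun q hq => hq.1.le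
  obtain ⟨q, hq, hq'⟩ := (hev.and (Ioo_mem_nhdsLT (zero_lt_one (α := ℝ)))).exists
  exact ⟨q, hq'.1, hq'.2, hq⟩

end DeepSparseCoding

/-! ### Propagation of the error through all dictionaries. -/

theorem mainTheorem3 (J : ℕ) (d : Fin (J + 1) → ℕ) :
    ∃ A : ℕ, ∀ (D : Dictionaries d) (lam : Fin J → ℝ),
      (∀ j, ColumnNormalized (D j)) → UniquenessCondition D lam →
      ∃ c : ℝ, 0 < c ∧ ∀ B : Fin J → ℝ, ∃ C : ℝ, 0 < C ∧
        ∀ (K : ℕ), 1 ≤ K → ∀ δ : Fin J → ℝ, ∃ M₀ : ℝ, ∀ M : ℝ, M₀ ≤ M →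
          ∀ (ρ : ℝ → ℝ) (φ : Network 1 1) (ε : ℝ), ApproximatesReLU ρ φ M ε →
            ∃ (Φ : Network (d 0) (d (Fin.last J)))
              (Ψ : (j : Fin J) → Network (d 0) (d j.succ)),
              (∀ j, (Ψ j).IsInitialSegment Φ) ∧
              Φ.depth ≤ A * K * (φ.depth + 1) ∧
              Φ.numWeights ≤ A * K * (φ.numWeights + 1) ∧
              ∀ (tol : Fin J → ℝ) (y : Fin (d 0) → ℝ) (x : (j : Fin (J + 1)) → Fin (d j) → ℝ),
                IsSparseCoding D lam tol y x →
                (∀ j : Fin J, (x j.succ, noise D x j) ∈ boundedClass _ _ (B j) (δ j)) →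
                ∀ j : Fin J, l2norm ((Ψ j).eval ρ y - x j.succ) ≤
                  C * Real.exp (-c * K) + C * ∑ i ∈ Finset.Iic j, δ i + C * ε := by
  refine ⟨∑ j : Fin J, Network.thresholdingCost (d j.castSucc) (d j.succ),
    fun D lam hD hlam => ?_⟩
  obtain ⟨q, hq₀, hq₁, hq⟩ := hlam.exists_factor
  refine ⟨-Real.log q, neg_pos.mpr (Real.log_neg hq₀ hq₁), fun B => ?_⟩
  choose Cs hCs using fun j => (hD j).exists_recovery hq₀.le hq₁ (hq j) (B j)
  obtain ⟨C', hC'⟩ := Finite.exists_le Cs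
  set C₁ : ℝ := max C' 1
  have hC₁ : 1 ≤ C₁ := le_max_right _ _
  have hCsC₁ : ∀ j, Cs j ≤ C₁ := fun j => (hC' j).trans (le_max_left _ _)
  refine ⟨(2 * C₁) ^ J, by positivity, fun K hK δ => ?_⟩
  have hexp : Real.exp (-(-Real.log q) * K) = q ^ K := by
    rw [neg_neg, mul_comm, Real.exp_nat_mul, Real.exp_log hq₀]
  rw [hexp]
  have hqK : 0 < q ^ K := pow_pos hq₀ K
  -- A negative `δ j` admits no signals, but the recovery networks need a nonnegative noise level.
  let δ' : Fin J → ℝ := fun j => max (δ j) 0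
  have hδ' : ∀ j, 0 ≤ δ' j := fun j => le_max_right _ _
  -- A layer turns error `e` into at most `C₁ * (q ^ K + δ' + e + ε)`; the 2 in `2 * C₁` absorbs the
  -- terms next to `e`.
  let err : Fin (J + 1) → ℝ → ℝ := fun j ε =>
    (2 * C₁) ^ (j : ℕ) * (q ^ K + ∑ i with i.castSucc < j, δ' i + ε)
  have hsum : ∀ j : Fin (J + 1), 0 ≤ ∑ i with i.castSucc < j, δ' i :=
    fun j => Finset.sum_nonneg fun i _ => hδ' i
  have herr : ∀ j ε, 0 ≤ ε → 0 ≤ err j ε := fun j ε hε => by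
    have := hsum j
    positivity
  -- The noise cap `H` is the level reached at `ε = 1`, so that `M₀` is fixed before `ε`.
  choose M₀ hM₀ hM₀' using fun j =>
    hCs j K hK (δ' j + err j.castSucc 1) (add_nonneg (hδ' j) (herr _ _ zero_le_one))
  obtain ⟨M', hM'⟩ := Finite.exists_le M₀
  refine ⟨M', fun M hM ρ φ ε hφ => ?_⟩
  -- For `J = 0` nothing forces `M ≥ 0`, so `0 ≤ ε` needs an index.
  have hε : ∀ _ : Fin J, 0 ≤ ε := fun j => hφ.nonneg ((hM₀ j).trans ((hM' j).trans hM))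
  choose S hSd hSw hS using fun j => hM₀' j M ((hM' j).trans hM) ρ φ ε hφ
    (δ' j + err j.castSucc ε) (add_nonneg (hδ' j) (herr _ _ (hε j))) fun h => by
      simp only [err]; gcongr
  obtain ⟨Ψ, hΨ₀, hΨ, hseg, hdepth, hweights⟩ := Network.exists_chain S
  refine ⟨Ψ (Fin.last J), fun j => Ψ j.succ, fun j => hseg _, ?_, ?_,
    fun tol y x hx hbound j => ?_⟩
  · rw [hdepth, Finset.sum_mul, Finset.sum_mul]
    exact Finset.sum_le_sum fun j _ => hSd j
  · rw [hweights, Finset.sum_mul, Finset.sum_mul]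
    exact Finset.sum_le_sum fun j _ => hSw j
  have hε₀ := hε j
  have hδ : ∀ i, δ' i = δ i := fun i =>
    max_eq_left ((Finset.sum_nonneg fun _ _ => abs_nonneg _).trans (hbound i).2)
  have main : ∀ k, l2norm ((Ψ k).eval ρ y - x k) ≤ err k ε := by
    intro k
    induction k using Fin.induction with
    | zero =>
      rw [hΨ₀, hx.observation, sub_self, l2norm_zero]
      exact herr _ _ hε₀
    | succ k ih =>
      -- Relative to `D k`, the computed input has the true noise plus the error of the preceding
      -- layer.
      have hnoise : l2norm ((Ψ k.castSucc).eval ρ y - (D k).mulVec (x k.succ)) ≤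
          δ' k + err k.castSucc ε := by
        have e := l2norm_add_le (noise D x k) ((Ψ k.castSucc).eval ρ y - x k.castSucc)
        have e' : noise D x k + ((Ψ k.castSucc).eval ρ y - x k.castSucc) =
            (Ψ k.castSucc).eval ρ y - (D k).mulVec (x k.succ) := by
          rw [noise]; abel
        rw [e'] at e
        refine e.trans (add_le_add ?_ ih)
        rw [hδ]
        exact (l2norm_le_l1norm _).trans (hbound k).2
      have hstep := hS k (x k.succ) ((Ψ k.castSucc).eval ρ y) (hx.sparsity k) (hbound k).1 hnoise
      rw [hΨ]
      have hset : ∑ i with i.castSucc < k.succ, δ' i =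
          δ' k + ∑ i with i.castSucc < k.castSucc, δ' i := by
        rw [← Finset.sum_insert (by simp)]
        refine Finset.sum_congr ?_ fun _ _ => rfl
        ext i
        simp [le_iff_eq_or_lt]
      have hpow : 1 ≤ (2 * C₁) ^ (k : ℕ) := one_le_pow₀ (by linarith)
      have herr₀ := herr k.castSucc ε hε₀
      calc _ ≤ Cs k * (q ^ K + (δ' k + err k.castSucc ε) + ε) := hstep
        _ ≤ C₁ * (q ^ K + (δ' k + err k.castSucc ε) + ε) := by
            have := hδ' k
            gcongr
            exact hCsC₁ k
        _ ≤ C₁ * (2 * ((2 * C₁) ^ (k : ℕ) *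
              (q ^ K + (δ' k + ∑ i with i.castSucc < k.castSucc, δ' i) + ε))) := by
            gcongr
            have e1 : q ^ K + δ' k + ε ≤ (2 * C₁) ^ (k : ℕ) * (q ^ K + δ' k + ε) :=
              le_mul_of_one_le_left (by linarith [hδ' k]) hpow
            have e2 : 0 ≤ (2 * C₁) ^ (k : ℕ) * ∑ i with i.castSucc < k.castSucc, δ' i :=
              mul_nonneg (by positivity) (hsum _)
            have e3 : 0 ≤ (2 * C₁) ^ (k : ℕ) * δ' k := mul_nonneg (by positivity) (hδ' k)
            simp only [err, Fin.val_castSucc]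
            linarith
        _ = err k.succ ε := by
            simp only [err, hset, Fin.val_succ]
            ring
  refine (main j.succ).trans ?_
  have hset : ∑ i with i.castSucc < j.succ, δ' i = ∑ i ∈ Finset.Iic j, δ i := by
    simp only [hδ]
    refine Finset.sum_congr ?_ fun _ _ => rfl
    ext i
    simp
  rw [← mul_add, ← mul_add, ← hset]
  have := hsum j.succ
  refine mul_le_mul_of_nonneg_right ?_ (by positivity)
  exact pow_le_pow_right₀ (by linarith) (by rw [Fin.val_succ]; exact j.isLt)
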